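/- **Proposition 4.1.** Let $X$ be a closed surface with a cell division $T$ obtained by gluing finitely many triangles in pairs along their sides (no side being glued to itself); corners of one triangle may become the same vertex of $T$ and sides of one triangle may be glued together. So $T$ may be any triangulation, or any generalized triangulation (a cell division whose lift to the universal cover is a triangulation). Let $V$, $E$ be the sets of vertices and edges and let $\Phi:E\to[0,\pi)$ be a weight. Fix a background geometry $\mathbb E^2$, $\mathbb H^2$ or $\mathbb S^2$. A *circle packing metric* based on $(T,\Phi)$ is a vector of radii $r=(r_v)_{v\in V}$, $r_v>0$, such that for each triangle of $T$ there are three circles whose radii are those at its vertices, which meet pairwise at the angles given by $\Phi$ on its edges ($\Phi=0$ meaning external tangency), and whose centres form a non-degenerate triangle in the background geometry; in $\mathbb S^2$ it is also required that the three radii of each triangle have sum less than $\pi$. The curvature $K_v(r)$ is $2\pi$ minus the sum of the inner angles, in these triangles of centres, at all corners that lie at $v$. For $I\subset V$ let $F_I$ be the subcomplex of all cells of $T$ whose vertices are in $I$, let $\chi(F_I)$ be its Euler characteristic, and let $Lk(I)$ be the collection of pairs $(e,v)$ of an edge $e$ with no end point in $I$ and a vertex $v\in I$ such that $e$ and $v$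 form a triangle of $T$, a pair being counted once for each triangle that it forms. (a) Let $I\subset V$ and let $r^{(n)}$ be a sequence of circle packing metrics based on $(T,\Phi)$ such that $\lim_{n\to\infty} r^{(n)}_v=0$ for $v\in I$, and for $v\notin I$ the limit $\lim_{n\to\infty} r_v^{(n)}$ exists in $(0,\infty)$, and in $(0,\pi)$ if the background geometry is $\mathbb S^2$. Then $$\lim_{n\to\infty}\sum_{v\in I}K_v(r^{(n)})=-\sum_{(e,v)\in Lk(I)}(\pi-\Phi(e))+2\pi\chi(F_I).$$ (b) If $X$ is connected, $\Phi(E)\subset[0,\pi/2]$ and the background geometry is $\mathbb E^2$ or $\mathbb H^2$, then for every circle packing metric $r$ based on $(T,\Phi)$ (here these are all the vectors of positive radii) and every non-empty proper subset $I$ of $V$, $$\sum_{v\in I}K_v(r)>-\sum_{(e,v)\in Lk(I)}(\pi-\Phi(e))+2\pi\chi(F_I).$$ -/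

import Mathlib

open Filter Topology

noncomputable section

/-- An oriented side of one of the triangles of a family indexed by `F`. The corners of each
triangle are numbered by `Fin 3`; the oriented side runs from the corner `src` to the corner
`tgt` of the triangle `tri`. -/
@[ext]
structure OrientedSide (F : Type*) where
  tri : F
  src : Fin 3
  tgt : Fin 3
  ne : src ≠ tgt

/-- The same side with the opposite orientation. -/
def OrientedSide.rev {F : Type*} (s : OrientedSide F) : OrientedSide F :=
  ⟨s.tri, s.tgt, s.src, s.ne.symm⟩

/-- A closed surface `X` cut into triangles, given as a gluing of the triangles of the family `F`:
the sides are identified in pairs by `glue`, which takes each oriented side to the oriented side of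
the same or of another triangle that it is identified with (start with start, end with end).
No side is identified with itself. When `F` is finite, the quotient of the disjoint union
of the triangles is a closed surface (orientable or not, connected or not) with a cell
division into triangles. Distinct corners of a triangle may become the same vertex, two edges may
have the same ends, and so on; so all triangulations, and all cell divisions whose lift
to the universal cover is a triangulation, are of this form. -/
structure TriangulatedSurface (F : Type*) where
  glue : OrientedSide F → OrientedSide F
  glue_glue : ∀ s, glue (glue s) = s
  glue_rev : ∀ s, glue s.rev = (glue s).rev
  glue_ne : ∀ s, glue s ≠ s
  glue_ne_rev : ∀ s, glue s ≠ s.rev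

namespace TriangulatedSurface

variable {F : Type*} (T : TriangulatedSurface F)

/-- The surface is connected: one can get from any triangle to any other by crossing sides. -/
def Connected : Prop :=
  ∀ f g : F, Relation.ReflTransGen
    (fun f₁ f₂ => ∃ s : OrientedSide F, s.tri = f₁ ∧ (T.glue s).tri = f₂) f g

/-- Two corners of triangles that are identified directly: the starts of two identified
oriented sides. (The ends are the starts of the reversed sides.) -/
def CornerRel (c d : F × Fin 3) : Prop :=
  ∃ s : OrientedSide F, c = (s.tri, s.src) ∧ d = ((T.glue s).tri, (T.glue s).src)

/-- The vertices (0-cells): classes of corners of triangles under the equivalence relation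
generated by the gluing. -/
def Vertex : Type _ := Quot T.CornerRel

/-- Two oriented sides that carry the same unoriented edge of the surface. -/
def SideRel (s t : OrientedSide F) : Prop := t = s.rev ∨ t = T.glue s

/-- The edges (1-cells): classes of sides of triangles, without orientation. -/
def Edge : Type _ := Quot T.SideRel

/-- The vertex of the surface at the corner `a` of the triangle `f`. -/
def vertex (f : F) (a : Fin 3) : T.Vertex := Quot.mk _ (f, a)

/-- The edge of the surface that a side of a triangle becomes. -/
def edge (s : OrientedSide F) : T.Edge := Quot.mk _ s

/-- The edge of the triangle `f` opposite to its corner `a`. -/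
def oppEdge (f : F) (a : Fin 3) : T.Edge :=
  T.edge ⟨f, a + 1, a + 2, by fin_cases a <;> decide⟩

/-- The set of end points of an edge. -/
def ends (e : T.Edge) : Set T.Vertex :=
  {v | ∃ s : OrientedSide F, T.edge s = e ∧ T.vertex s.tri s.src = v}

instance [Finite F] : Finite (OrientedSide F) :=
  Finite.of_injective (fun s : OrientedSide F => (s.tri, s.src, s.tgt)) (by
    intro s t h
    simp only [Prod.mk.injEq] at h
    exact OrientedSide.ext h.1 h.2.1 h.2.2)

instance [Finite F] : Finite T.Vertex :=
  Finite.of_surjective (Quot.mk T.CornerRel) Quot.mk_surjective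

instance [Finite F] : Finite T.Edge :=
  Finite.of_surjective (Quot.mk T.SideRel) Quot.mk_surjective

instance [Finite F] : Fintype T.Vertex := Fintype.ofFinite _

instance [Finite F] : Fintype T.Edge := Fintype.ofFinite _

/-- The Euler characteristic of the subcomplex `F_I` of all cells whose vertices are
in `I`: the number of its vertices, minus the number of its edges, plus the number
of its triangles. -/
def eulerChar [Fintype F] (I : Finset T.Vertex) : ℤ :=
  (I.card : ℤ) - (Nat.card {e : T.Edge // T.ends e ⊆ I} : ℤ)
    + (Nat.card {f : F // ∀ a, T.vertex f a ∈ I} : ℤ)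

open Classical in
/-- The link `Lk(I)`: the pairs `(e, v)` of an edge `e` with no end point in `I` and a vertex
`v` in `I` that form a triangle, one for each triangle that they form. The pair is recorded by the
triangle `f` and its corner `a` at `v`; then `v = T.vertex f a` and `e = T.oppEdge f a`. -/
def link [Fintype F] (I : Finset T.Vertex) : Finset (F × Fin 3) :=
  Finset.univ.filter fun c =>
    Disjoint (T.ends (T.oppEdge c.1 c.2)) (I : Set T.Vertex) ∧ T.vertex c.1 c.2 ∈ I

end TriangulatedSurface

/-- The three background geometries: the plane, the hyperbolic plane and the unit sphere. -/
inductive Background where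
  | euclidean
  | hyperbolic
  | spherical

namespace Background

/-- The distance between the centres of two circles of radii `r` and `s` that meet at the angle
`φ`; the radii drawn to a point of intersection make the angle `π - φ` there, so `φ = 0` is
external tangency. -/
def dist : Background → (r s φ : ℝ) → ℝ
  | euclidean, r, s, φ => Real.sqrt (r ^ 2 + s ^ 2 + 2 * r * s * Real.cos φ)
  | hyperbolic, r, s, φ =>
      Real.arcosh (Real.cosh r * Real.cosh s + Real.sinh r * Real.sinh s * Real.cos φ)
  | spherical, r, s, φ =>
      Real.arccos (Real.cos r * Real.cos s - Real.sin r * Real.sin s * Real.cos φ)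

/-- The inner angle, opposite to the side of length `a`, of the triangle with side lengths
`a`, `b`, `c`, by the law of cosines. -/
def angle : Background → (a b c : ℝ) → ℝ
  | euclidean, a, b, c => Real.arccos ((b ^ 2 + c ^ 2 - a ^ 2) / (2 * b * c))
  | hyperbolic, a, b, c => Real.arccos
      ((Real.cosh b * Real.cosh c - Real.cosh a) / (Real.sinh b * Real.sinh c))
  | spherical, a, b, c => Real.arccos
      ((Real.cos a - Real.cos b * Real.cos c) / (Real.sin b * Real.sin c))

end Background

namespace TriangulatedSurface

variable {F : Type*} (T : TriangulatedSurface F)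

/-- The length of the side opposite to the corner `a` in the triangle `f`, for the
weight `Φ` and the radii `r`. -/
def sideLength (K : Background) (Φ : T.Edge → ℝ) (r : T.Vertex → ℝ) (f : F) (a : Fin 3) : ℝ :=
  K.dist (r (T.vertex f (a + 1))) (r (T.vertex f (a + 2))) (Φ (T.oppEdge f a))

/-- The radii `r` define a circle packing metric with weight `Φ` in the geometry `K`: they are
positive, in spherical geometry the three radii of each triangle add up to less than `π`, and for
each triangle the three circles of the given radii meeting at the given angles exist, with centres
that form a non-degenerate triangle, that is, the distances of the centres satisfy the strict
triangle inequalities. (In spherical geometry, that the perimeter is less than `2π` then follows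
from the bound on the radii.) -/
structure IsCirclePackingMetric (K : Background) (Φ : T.Edge → ℝ) (r : T.Vertex → ℝ) : Prop where
  pos : ∀ v, 0 < r v
  sum_lt_pi : K = Background.spherical →
    ∀ f, r (T.vertex f 0) + r (T.vertex f 1) + r (T.vertex f 2) < Real.pi
  triangle : ∀ f a, T.sideLength K Φ r f a
    < T.sideLength K Φ r f (a + 1) + T.sideLength K Φ r f (a + 2)

/-- The inner angle at the corner `a` of the triangle `f`. -/
def innerAngle (K : Background) (Φ : T.Edge → ℝ) (r : T.Vertex → ℝ) (f : F) (a : Fin 3) : ℝ :=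
  K.angle (T.sideLength K Φ r f a) (T.sideLength K Φ r f (a + 1)) (T.sideLength K Φ r f (a + 2))

open Classical in
/-- The curvature at a vertex: `2π` minus the cone angle, which is the sum of the inner
angles at all corners of triangles that lie at the vertex. -/
def curvature [Fintype F] (K : Background) (Φ : T.Edge → ℝ) (r : T.Vertex → ℝ) (v : T.Vertex) :
    ℝ :=
  2 * Real.pi - ∑ c : F × Fin 3 with T.vertex c.1 c.2 = v, T.innerAngle K Φ r c.1 c.2

end TriangulatedSurface

end

/-!
Both sides are sums over triangles. Exchanging the sums over vertices and corners,
`∑ v ∈ I, K_v = 2π |I| - ∑ f, (angles of f at corners in I)` (`sum_curvature`). On the other side,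
each edge is carried by exactly two sides of triangles (`card_edge_eq`), so the combinatorial
expression is `2π |I| - ∑ f, limitAngle f` (`sum_limitAngle`), where `limitAngle f` is `π` for a
triangle with two or three corners in `I`, `π - Φ(e)` for a triangle with the single corner opposite
to `e` in `I`, and `0` otherwise. It remains to compare the two contributions of one triangle.

If only one circle of a triangle shrinks, the law of cosines is continuous at the limit and gives
`π - Φ(e)` (`angle_dist`). If two or three shrink, some side shrinks to a point and the other two
get the same length; then the angle sum tends to `π` (`tendsto_angle_sum`), and the angle at the
remaining corner tends to `0` if its circle does not shrink. When all three circles shrink the shape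
of the triangle need not converge, and may degenerate. The angle sum is therefore
controlled through the excess `A + B + C - π`. With the generalized sine `sn` and cosine `cs` of the geometry, of
curvature `κ`, and the semi-perimeter `s`, Cagnoli's formula
`cos² ((A + B + C) / 2)
  = κ² sn s sn (s - a) sn (s - b) sn (s - c) / (2 cs (a / 2) cs (b / 2) cs (c / 2))²`
(`IsTriangle.cos_halfSum_sq`) shows that `cos ((A + B + C) / 2)` tends to `0`, and
`IsTriangle.halfSum_lt` excludes the value `3π / 2` for the limit of `(A + B + C) / 2`.

For the inequality, weights at most `π / 2` make the triangles exist for all radii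
(`isTriangle_dist`), and then a single angle is less than `π - Φ(e)` (`angle_dist_lt`) and the angle
sum is at most `π` (`IsTriangle.angle_sum_le`), so two angles add up to less than `π`. By
connectedness some triangle has corners both inside and outside of `I`
(`Connected.exists_mixed_triangle`), and its inequality is strict.
-/

noncomputable section

/-! ### Trigonometry of triangles in the three geometries -/

namespace Background

/-- The generalized sine of a geometry: `t`, `sinh t` or `sin t`. -/
def sn : Background → ℝ → ℝ
  | euclidean, t => t
  | hyperbolic, t => Real.sinh t
  | spherical, t => Real.sin t

/-- The generalized cosine of a geometry: `1`, `cosh t` or `cos t`. -/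
def cs : Background → ℝ → ℝ
  | euclidean, _ => 1
  | hyperbolic, t => Real.cosh t
  | spherical, t => Real.cos t

/-- The Gaussian curvature of a geometry. -/
def gauss : Background → ℝ
  | euclidean => 0
  | hyperbolic => -1
  | spherical => 1

/-- `a`, `b`, `c` are the side lengths of a non-degenerate triangle of the geometry: the strict
triangle inequalities hold and, on the sphere, the perimeter is less than `2π`. -/
structure IsTriangle (K : Background) (a b c : ℝ) : Prop where
  lt₁ : a < b + c
  lt₂ : b < c + a
  lt₃ : c < a + b
  perimeter : K = spherical → a + b + c < 2 * Real.pi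

variable {K : Background} {a b c : ℝ}

theorem IsTriangle.rotate (h : K.IsTriangle a b c) : K.IsTriangle b c a :=
  ⟨h.lt₂, h.lt₃, h.lt₁, fun hK => by linarith [h.perimeter hK]⟩

theorem sn_pos {t : ℝ} (h₀ : 0 < t) (h₁ : K = spherical → t < Real.pi) : 0 < K.sn t := by
  cases K
  · exact h₀
  · exact Real.sinh_pos_iff.2 h₀
  · exact Real.sin_pos_of_pos_of_lt_pi h₀ (h₁ rfl)

theorem cs_pos {t : ℝ} (h₀ : 0 ≤ t) (h₁ : K = spherical → t < Real.pi / 2) : 0 < K.cs t := by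
  cases K
  · exact one_pos
  · exact Real.cosh_pos t
  · exact Real.cos_pos_of_mem_Ioo ⟨by linarith [Real.pi_pos], h₁ rfl⟩

theorem continuous_sn : Continuous K.sn := by
  cases K
  · exact continuous_id
  · exact Real.continuous_sinh
  · exact Real.continuous_sin

theorem continuous_cs : Continuous K.cs := by
  cases K
  · exact continuous_const
  · exact Real.continuous_cosh
  · exact Real.continuous_cos

theorem sn_zero : K.sn 0 = 0 := by
  cases K
  · rfl
  · exact Real.sinh_zero
  · exact Real.sin_zero

theorem sn_add (s t : ℝ) : K.sn (s + t) = K.sn s * K.cs t + K.cs s * K.sn t := by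
  cases K
  · simp [sn, cs]
  · exact Real.sinh_add s t
  · exact Real.sin_add s t

theorem sn_sub (s t : ℝ) : K.sn (s - t) = K.sn s * K.cs t - K.cs s * K.sn t := by
  cases K
  · simp [sn, cs]
  · exact Real.sinh_sub s t
  · exact Real.sin_sub s t

theorem cs_sq_add (t : ℝ) : K.cs t ^ 2 + K.gauss * K.sn t ^ 2 = 1 := by
  cases K
  · simp [gauss, cs]
  · simp only [gauss, cs, sn]; linarith [Real.cosh_sq t]
  · simp [gauss, cs, sn]

theorem cs_add (s t : ℝ) : K.cs (s + t) = K.cs s * K.cs t - K.gauss * (K.sn s * K.sn t) := by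
  cases K
  · simp [gauss, cs]
  · simp only [gauss, cs, sn, Real.cosh_add]; ring
  · simp only [gauss, cs, sn, Real.cos_add]; ring

theorem sn_mul_add_sn_mul (x y z : ℝ) :
    K.sn (x + y + z) * K.sn x + K.sn y * K.sn z = K.sn (z + x) * K.sn (x + y) := by
  have h := cs_sq_add (K := K) x
  simp only [sn_add, cs_add]
  linear_combination (- K.sn y * K.sn z) * h

/-- The half-angle form of the law of cosines, for the triangle whose semi-perimeter exceeds the
side lengths by `x`, `y`, `z`. -/
theorem angle_add_add_add (x y z : ℝ) :
    K.angle (y + z) (z + x) (x + y) = Real.arccos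
      ((K.sn (x + y + z) * K.sn x - K.sn y * K.sn z)
        / (K.sn (x + y + z) * K.sn x + K.sn y * K.sn z)) := by
  rw [sn_mul_add_sn_mul]
  cases K
  · simp only [angle, sn]
    congr 1
    rw [mul_assoc, show (z + x) ^ 2 + (x + y) ^ 2 - (y + z) ^ 2
      = 2 * ((x + y + z) * x - y * z) by ring, mul_div_mul_left _ _ two_ne_zero]
  · simp only [angle, sn]
    congr 2
    simp only [Real.sinh_add, Real.cosh_add]
    linear_combination (Real.cosh y * Real.cosh z) * Real.cosh_sq x
  · simp only [angle, sn]
    congr 2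
    simp only [Real.sin_add, Real.cos_add]
    linear_combination (-Real.cos y * Real.cos z) * Real.sin_sq_add_cos_sq x

/-- The sum-to-product formula that relates the angle excess to the curvature: both sides vanish
in the flat geometry, where `sn t = t`. -/
theorem sn_semiperimeter_sub (a b c : ℝ) :
    K.sn ((a + b + c) / 2) - K.sn ((b + c - a) / 2) - K.sn ((c + a - b) / 2)
        - K.sn ((a + b - c) / 2)
      = -4 * K.gauss * (K.sn (a / 2) * K.sn (b / 2) * K.sn (c / 2)) := by
  obtain ⟨u, hu⟩ : ∃ u, u = (b + c - a) / 4 := ⟨_, rfl⟩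
  obtain ⟨v, hv⟩ : ∃ u, u = (c + a - b) / 4 := ⟨_, rfl⟩
  obtain ⟨w, hw⟩ : ∃ u, u = (a + b - c) / 4 := ⟨_, rfl⟩
  rw [show (a + b + c) / 2 = u + u + (v + v) + (w + w) by linarith,
    show (b + c - a) / 2 = u + u by linarith, show (c + a - b) / 2 = v + v by linarith,
    show (a + b - c) / 2 = w + w by linarith, show a / 2 = v + w by linarith,
    show b / 2 = w + u by linarith, show c / 2 = u + v by linarith]
  have h₁ := cs_sq_add (K := K) u
  have h₂ := cs_sq_add (K := K) v
  have h₃ := cs_sq_add (K := K) w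
  simp only [sn_add, cs_add]
  grind

theorem _root_.Real.arccos_sub_div_add {P Q : ℝ} (hP : 0 < P) (hQ : 0 ≤ Q) :
    Real.arccos ((P - Q) / (P + Q)) = 2 * Real.arctan √(Q / P) := by
  have h0 : 0 ≤ Real.arctan √(Q / P) := Real.arctan_nonneg.2 (Real.sqrt_nonneg _)
  rw [← Real.arccos_cos (x := 2 * Real.arctan √(Q / P)) (by linarith)
    (by linarith [Real.arctan_lt_pi_div_two √(Q / P)]), Real.cos_two_mul, Real.cos_sq_arctan,
    Real.sq_sqrt (div_nonneg hQ hP.le)]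
  congr 1
  field_simp
  ring

theorem sn_two_mul (t : ℝ) : K.sn t = 2 * K.sn (t / 2) * K.cs (t / 2) := by
  conv_lhs => rw [← add_halves t, sn_add]
  ring

/-- Half of the sum of the three inner angles. -/
def halfSum (K : Background) (a b c : ℝ) : ℝ :=
  (K.angle a b c + K.angle b c a + K.angle c a b) / 2

/-- The half-angle formulas in the form `tan (A / 2) = m / sn (s - a)`, with the same `m` for the
three angles. Here `m` is the generalized tangent of the radius of the inscribed circle, and the
numbers `p`, `x`, `y`, `z` are the generalized sines of the semi-perimeter `s` and of `s - a`,
`s - b`, `s - c`. -/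
theorem IsTriangle.exists_half_angles (h : K.IsTriangle a b c) :
    ∃ p x y z m α β γ : ℝ, p = K.sn ((a + b + c) / 2) ∧ x = K.sn ((b + c - a) / 2) ∧
      y = K.sn ((c + a - b) / 2) ∧ z = K.sn ((a + b - c) / 2) ∧
      0 < p ∧ 0 < x ∧ 0 < y ∧ 0 < z ∧ 0 < m ∧ m ^ 2 * p = x * y * z ∧
      p * x + y * z = K.sn b * K.sn c ∧ p * y + z * x = K.sn c * K.sn a ∧
      p * z + x * y = K.sn a * K.sn b ∧
      α ∈ Set.Ioo 0 (Real.pi / 2) ∧ β ∈ Set.Ioo 0 (Real.pi / 2) ∧ γ ∈ Set.Ioo 0 (Real.pi / 2) ∧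
      K.angle a b c = 2 * α ∧ K.angle b c a = 2 * β ∧ K.angle c a b = 2 * γ ∧
      Real.sin α * x = m * Real.cos α ∧ Real.sin β * y = m * Real.cos β ∧
      Real.sin γ * z = m * Real.cos γ := by
  obtain ⟨u, hu⟩ : ∃ u, u = (b + c - a) / 2 := ⟨_, rfl⟩
  obtain ⟨v, hv⟩ : ∃ u, u = (c + a - b) / 2 := ⟨_, rfl⟩
  obtain ⟨w, hw⟩ : ∃ u, u = (a + b - c) / 2 := ⟨_, rfl⟩
  obtain rfl : a = v + w := by linarith
  obtain rfl : b = w + u := by linarith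
  obtain rfl : c = u + v := by linarith
  have hu0 : 0 < u := by linarith [h.lt₁]
  have hv0 : 0 < v := by linarith [h.lt₂]
  have hw0 : 0 < w := by linarith [h.lt₃]
  have hs : K = spherical → u + v + w < Real.pi := fun hK => by linarith [h.perimeter hK]
  have hp : 0 < K.sn (u + v + w) := sn_pos (by linarith) hs
  have hx : 0 < K.sn u := sn_pos hu0 fun hK => by linarith [hs hK]
  have hy : 0 < K.sn v := sn_pos hv0 fun hK => by linarith [hs hK]
  have hz : 0 < K.sn w := sn_pos hw0 fun hK => by linarith [hs hK]
  have hA := angle_add_add_add (K := K) u v w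
  have hB := angle_add_add_add (K := K) v w u
  have hC := angle_add_add_add (K := K) w u v
  have e₁ := sn_mul_add_sn_mul (K := K) u v w
  have e₂ := sn_mul_add_sn_mul (K := K) v w u
  have e₃ := sn_mul_add_sn_mul (K := K) w u v
  rw [show v + w + u = u + v + w by ring] at hB e₂
  rw [show w + u + v = u + v + w by ring] at hC e₃
  rw [show (v + w + (w + u) + (u + v)) / 2 = u + v + w by ring, ← hu, ← hv, ← hw]
  rw [Real.arccos_sub_div_add (by positivity) (by positivity)] at hA hB hC
  clear hu hv hw h
  generalize K.sn (u + v + w) = p at *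
  generalize K.sn u = x at *
  generalize K.sn v = y at *
  generalize K.sn w = z at *
  have key : ∀ x y z : ℝ, 0 < x → 0 < y → 0 < z →
      Real.arctan √(y * z / (p * x)) ∈ Set.Ioo 0 (Real.pi / 2) ∧
      Real.sin (Real.arctan √(y * z / (p * x))) * x
        = √(x * y * z / p) * Real.cos (Real.arctan √(y * z / (p * x))) := by
    intro x y z hx hy hz
    have hr : √(y * z / (p * x)) = √(x * y * z / p) / x := by
      rw [show y * z / (p * x) = (x * y * z / p) / x ^ 2 by field_simp,
        Real.sqrt_div (by positivity), Real.sqrt_sq hx.le]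
    refine ⟨⟨Real.arctan_pos.2 (by positivity), Real.arctan_lt_pi_div_two _⟩, ?_⟩
    rw [← Real.tan_mul_cos (Real.cos_arctan_pos _).ne', Real.tan_arctan, hr]
    field_simp
  obtain ⟨a₁, a₂⟩ := key x y z hx hy hz
  obtain ⟨b₁, b₂⟩ := key y z x hy hz hx
  obtain ⟨c₁, c₂⟩ := key z x y hz hx hy
  rw [show y * z * x = x * y * z by ring] at b₂
  rw [show z * x * y = x * y * z by ring] at c₂
  refine ⟨p, x, y, z, √(x * y * z / p), _, _, _, rfl, rfl, rfl, rfl, hp, hx, hy, hz, by positivity,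
    ?_, e₁, e₂, e₃, a₁, b₁, c₁, hA, hB, hC, a₂, b₂, c₂⟩
  rw [Real.sq_sqrt (by positivity)]
  field_simp

/-- The cosine of a sum of three angles with tangents `m / x`, `m / y`, `m / z`, where
`m ^ 2 = x * y * z / p`. -/
theorem _root_.Real.mul_cos_add_add_of_sin_mul_eq {p x y z m α β γ : ℝ} (h0 : x * y * z ≠ 0)
    (hm : m ^ 2 * p = x * y * z) (hα : Real.sin α * x = m * Real.cos α)
    (hβ : Real.sin β * y = m * Real.cos β) (hγ : Real.sin γ * z = m * Real.cos γ) :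
    p * Real.cos (α + β + γ)
      = (p - x - y - z) * (Real.cos α * Real.cos β * Real.cos γ) := by
  refine mul_left_cancel₀ h0 ?_
  simp only [Real.cos_add, Real.sin_add]
  grind

/-- Cagnoli's formula, squared: `cos ((A + B + C) / 2)` is minus the sine of half
the angle excess. -/
theorem IsTriangle.cos_halfSum_sq (h : K.IsTriangle a b c) :
    4 * (K.cs (a / 2) * K.cs (b / 2) * K.cs (c / 2)) ^ 2 * Real.cos (K.halfSum a b c) ^ 2
      = K.gauss ^ 2 * (K.sn ((a + b + c) / 2) * K.sn ((b + c - a) / 2) * K.sn ((c + a - b) / 2)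
        * K.sn ((a + b - c) / 2)) := by
  obtain ⟨p, x, y, z, m, α, β, γ, ep, ex, ey, ez, hp, hx, hy, hz, hm, hm2, e₁, e₂, e₃, -, -, -, hA,
    hB, hC, hα, hβ, hγ⟩ := h.exists_half_angles
  have hd := sn_semiperimeter_sub (K := K) a b c
  rw [← ep, ← ex, ← ey, ← ez] at hd
  rw [← ep, ← ex, ← ey, ← ez, halfSum, hA, hB, hC,
    show (2 * α + 2 * β + 2 * γ) / 2 = α + β + γ by ring]
  have sA := sn_two_mul (K := K) a
  have sB := sn_two_mul (K := K) b
  have sC := sn_two_mul (K := K) c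
  clear hA hB hC ep ex ey ez
  have hcos := Real.mul_cos_add_add_of_sin_mul_eq (by positivity) hm2 hα hβ hγ
  -- `cos² (A / 2) = sn s * sn (s - a) / (sn b * sn c)`
  have hsq : ∀ {x y z α q : ℝ}, 0 < x → m ^ 2 * p = x * y * z →
      Real.sin α * x = m * Real.cos α → p * x + y * z = q →
      Real.cos α ^ 2 * q = p * x := by
    intro x y z α q hx hm2 hα hq
    have : x * (Real.cos α ^ 2 * q) = x * (p * x) := by
      rw [← hq]
      linear_combination (-Real.cos α ^ 2) * hm2 - p * (Real.sin α * x + m * Real.cos α) * hα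
        + p * x ^ 2 * Real.sin_sq_add_cos_sq α
    exact mul_left_cancel₀ hx.ne' this
  have hα2 := hsq hx hm2 hα e₁
  have hβ2 := hsq hy (by linarith) hβ e₂
  have hγ2 := hsq hz (by linarith) hγ e₃
  have q1 : 0 < K.sn b * K.sn c := e₁ ▸ by positivity
  have q2 : 0 < K.sn c * K.sn a := e₂ ▸ by positivity
  have q3 : 0 < K.sn a * K.sn b := e₃ ▸ by positivity
  have hne : (K.sn a * K.sn b * K.sn c) ≠ 0 := by
    intro h0
    have : (K.sn b * K.sn c) * (K.sn c * K.sn a) * (K.sn a * K.sn b) = 0 := by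
      linear_combination (K.sn a * K.sn b * K.sn c) * h0
    exact (mul_pos (mul_pos q1 q2) q3).ne' this
  have hD : (Real.cos α * Real.cos β * Real.cos γ) ^ 2 * (K.sn a * K.sn b * K.sn c) ^ 2
      = p ^ 3 * (x * y * z) := by
    linear_combination (Real.cos β ^ 2 * (K.sn c * K.sn a) * (Real.cos γ ^ 2 * (K.sn a * K.sn b)))
      * hα2 + p * x * (Real.cos γ ^ 2 * (K.sn a * K.sn b)) * hβ2 + p * x * (p * y) * hγ2
  have hsn : K.sn a * K.sn b * K.sn c = 8 * (K.sn (a / 2) * K.sn (b / 2) * K.sn (c / 2))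
      * (K.cs (a / 2) * K.cs (b / 2) * K.cs (c / 2)) := by
    rw [sA, sB, sC]; ring
  generalize K.sn (a / 2) * K.sn (b / 2) * K.sn (c / 2) = S at *
  generalize K.cs (a / 2) * K.cs (b / 2) * K.cs (c / 2) = C at *
  generalize Real.cos α * Real.cos β * Real.cos γ = D at *
  generalize Real.cos (α + β + γ) = H at *
  rw [hsn] at hD hne
  have hS : S ≠ 0 := by rintro rfl; simp at hne
  have : p ^ 2 * S ^ 2 * (4 * C ^ 2 * H ^ 2) = p ^ 2 * S ^ 2 * (K.gauss ^ 2 * (p * x * y * z)) := by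
    rw [hd] at hcos
    linear_combination (4 * C ^ 2 * S ^ 2) * (p * H + (-4 * K.gauss * S) * D) * hcos
      + K.gauss ^ 2 * S ^ 2 * hD
  exact mul_left_cancel₀ (by positivity) this

theorem IsTriangle.halfSum_mem (h : K.IsTriangle a b c) :
    K.halfSum a b c ∈ Set.Ioo 0 (3 * Real.pi / 2) := by
  obtain ⟨p, x, y, z, m, α, β, γ, -, -, -, -, -, -, -, -, -, -, -, -, -, hα, hβ, hγ, hA, hB, hC, -⟩
    := h.exists_half_angles
  rw [halfSum, hA, hB, hC]
  constructor <;> linarith [hα.1, hα.2, hβ.1, hβ.2, hγ.1, hγ.2]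

theorem IsTriangle.angle_pos (h : K.IsTriangle a b c) : 0 < K.angle a b c := by
  obtain ⟨p, x, y, z, m, α, β, γ, -, -, -, -, -, -, -, -, -, -, -, -, -, hα, hβ, hγ, hA, hB, hC, -⟩
    := h.exists_half_angles
  linarith [hα.1]

/-- The angle sum is at most `π` if the geometry has no positive curvature. -/
theorem IsTriangle.angle_sum_le (h : K.IsTriangle a b c) (hK : K.gauss ≤ 0) :
    K.angle a b c + K.angle b c a + K.angle c a b ≤ Real.pi := by
  obtain ⟨p, x, y, z, m, α, β, γ, ep, ex, ey, ez, hp, hx, hy, hz, hm, hm2, -, -, -, iα, iβ, iγ, hA,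
    hB, hC, hα, hβ, hγ⟩ := h.exists_half_angles
  have hns : K ≠ spherical := by rintro rfl; norm_num [gauss] at hK
  have hd := sn_semiperimeter_sub (K := K) a b c
  rw [← ep, ← ex, ← ey, ← ez] at hd
  have ha : 0 < K.sn (a / 2) := sn_pos (by linarith [h.lt₂, h.lt₃]) (absurd · hns)
  have hb : 0 < K.sn (b / 2) := sn_pos (by linarith [h.lt₁, h.lt₃]) (absurd · hns)
  have hc : 0 < K.sn (c / 2) := sn_pos (by linarith [h.lt₁, h.lt₂]) (absurd · hns)
  have hnn : 0 ≤ p - x - y - z := by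
    rw [hd]
    exact mul_nonneg (by linarith) (by positivity)
  have cα := Real.cos_pos_of_mem_Ioo ⟨by linarith [iα.1, Real.pi_pos], iα.2⟩
  have cβ := Real.cos_pos_of_mem_Ioo ⟨by linarith [iβ.1, Real.pi_pos], iβ.2⟩
  have cγ := Real.cos_pos_of_mem_Ioo ⟨by linarith [iγ.1, Real.pi_pos], iγ.2⟩
  have hcos := Real.mul_cos_add_add_of_sin_mul_eq (by positivity) hm2 hα hβ hγ
  rw [hA, hB, hC]
  by_contra! hlt
  have : Real.cos (α + β + γ) < 0 := Real.cos_neg_of_pi_div_two_lt_of_lt (by linarith)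
    (by linarith [iα.2, iβ.2, iγ.2])
  have h1 : p * Real.cos (α + β + γ) < 0 := mul_neg_of_pos_of_neg hp this
  rw [hcos] at h1
  exact absurd h1 (not_lt.2 (by positivity))

/-- Half of the angle sum is less than `π` if two sides of the triangle add up to at most `π`.
Together with a value of `cos (K.halfSum a b c)` near `0`, this places the half sum near `π / 2`
rather than `3π / 2`. -/
theorem IsTriangle.halfSum_lt (h : K.IsTriangle a b c) (hK : K = spherical → c + a ≤ Real.pi) :
    K.halfSum a b c < Real.pi := by
  obtain ⟨p, x, y, z, m, α, β, γ, ep, ex, ey, ez, hp, hx, hy, hz, hm, hm2, -, -, -, iα, iβ, iγ, hA,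
    hB, hC, hα, hβ, hγ⟩ := h.exists_half_angles
  rw [halfSum, hA, hB, hC, show (2 * α + 2 * β + 2 * γ) / 2 = α + β + γ by ring] at *
  -- `sn s - sn (s - b) = 2 * cs ((c + a) / 2) * sn (b / 2)`
  have hpy : y ≤ p := by
    have hb : 0 < K.sn (b / 2) := sn_pos (by linarith [h.lt₁, h.lt₃])
      fun hs => by linarith [hK hs, h.lt₂, Real.pi_pos]
    have hca : 0 ≤ K.cs ((c + a) / 2) := by
      cases K
      · exact zero_le_one
      · exact (Real.cosh_pos _).le
      · exact Real.cos_nonneg_of_mem_Icc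
          ⟨by linarith [h.lt₁, h.lt₂, h.lt₃, Real.pi_pos], by linarith [hK rfl]⟩
    rw [ep, ey, show (a + b + c) / 2 = (c + a) / 2 + b / 2 by ring,
      show (c + a - b) / 2 = (c + a) / 2 - b / 2 by ring, sn_add, sn_sub]
    linarith [mul_nonneg hca hb.le]
  have cα := Real.cos_pos_of_mem_Ioo ⟨by linarith [iα.1, Real.pi_pos], iα.2⟩
  have cβ := Real.cos_pos_of_mem_Ioo ⟨by linarith [iβ.1, Real.pi_pos], iβ.2⟩
  have cγ := Real.cos_pos_of_mem_Ioo ⟨by linarith [iγ.1, Real.pi_pos], iγ.2⟩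
  have hsin : x * y * z * (p * Real.sin (α + β + γ))
      = m * (p * (x * y + y * z + z * x) - x * y * z) * (Real.cos α * Real.cos β * Real.cos γ) := by
    simp only [Real.cos_add, Real.sin_add]
    grind
  have hpos : 0 < p * (x * y + y * z + z * x) - x * y * z := by
    nlinarith [mul_le_mul_of_nonneg_left hpy (mul_pos hz hx).le, mul_pos hp (mul_pos hx hy),
      mul_pos hp (mul_pos hy hz)]
  by_contra! hge
  have : Real.sin (α + β + γ) ≤ 0 := by
    rw [← Real.sin_sub_two_pi]
    exact Real.sin_nonpos_of_nonpos_of_neg_pi_le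
      (by linarith [iα.2, iβ.2, iγ.2, Real.pi_pos]) (by linarith)
  have h1 : x * y * z * (p * Real.sin (α + β + γ)) ≤ 0 :=
    mul_nonpos_of_nonneg_of_nonpos (by positivity) (mul_nonpos_of_nonneg_of_nonpos hp.le this)
  rw [hsin] at h1
  exact absurd h1 (not_le.2 (by positivity))

end Background

/-! ### Centres of circles meeting at given angles -/

namespace Background

variable {K : Background} {a b c r s t φ ψ θ : ℝ}

theorem one_le_cosh_mul_cosh_add (r s φ : ℝ) :
    1 ≤ Real.cosh r * Real.cosh s + Real.sinh r * Real.sinh s * Real.cos φ := by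
  have h₁ := Real.one_le_cosh (r + s)
  have h₂ := Real.one_le_cosh (r - s)
  rw [Real.cosh_add] at h₁
  rw [Real.cosh_sub] at h₂
  nlinarith [mul_nonneg (sub_nonneg.2 h₁) (by linarith [Real.neg_one_le_cos φ] : 0 ≤ 1 + Real.cos φ),
    mul_nonneg (sub_nonneg.2 h₂) (sub_nonneg.2 (Real.cos_le_one φ))]

theorem cosh_dist (r s φ : ℝ) : Real.cosh (hyperbolic.dist r s φ)
    = Real.cosh r * Real.cosh s + Real.sinh r * Real.sinh s * Real.cos φ :=
  Real.cosh_arcosh (one_le_cosh_mul_cosh_add r s φ)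

theorem cos_dist (r s φ : ℝ) : Real.cos (spherical.dist r s φ)
    = Real.cos r * Real.cos s - Real.sin r * Real.sin s * Real.cos φ := by
  have h₁ := Real.cos_le_one (r - s)
  have h₂ := Real.neg_one_le_cos (r - s)
  have h₃ := Real.cos_le_one (r + s)
  have h₄ := Real.neg_one_le_cos (r + s)
  rw [Real.cos_sub] at h₁ h₂
  rw [Real.cos_add] at h₃ h₄
  have p : 0 ≤ 1 + Real.cos φ := by linarith [Real.neg_one_le_cos φ]
  have q : 0 ≤ 1 - Real.cos φ := by linarith [Real.cos_le_one φ]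
  refine Real.cos_arccos ?_ ?_ <;>
    nlinarith [mul_nonneg p (sub_nonneg.2 h₄), mul_nonneg q (sub_nonneg.2 h₂),
      mul_nonneg p (sub_nonneg.2 h₃), mul_nonneg q (sub_nonneg.2 h₁)]

theorem dist_sq (r s φ : ℝ) :
    euclidean.dist r s φ ^ 2 = r ^ 2 + s ^ 2 + 2 * r * s * Real.cos φ := by
  refine Real.sq_sqrt ?_
  nlinarith [sq_nonneg (r + s * Real.cos φ), mul_nonneg (sq_nonneg s)
    (sub_nonneg.2 (Real.cos_sq_le_one φ))]

/-- Continuity holds up to the boundary value `1` of the argument of `arcosh`, since `arcosh` is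
continuous on `[1, ∞)`. -/
theorem continuous_dist (K : Background) (φ : ℝ) :
    Continuous fun p : ℝ × ℝ => K.dist p.1 p.2 φ := by
  cases K
  · simp only [dist]
    fun_prop
  · exact Real.continuousOn_arcosh.comp_continuous (by fun_prop)
      fun p => one_le_cosh_mul_cosh_add p.1 p.2 φ
  · simp only [dist]
    exact Real.continuous_arccos.comp (by fun_prop)

theorem dist_zero_right (h₀ : 0 ≤ r) (h₁ : K = spherical → r ≤ Real.pi) : K.dist r 0 φ = r := by
  cases K
  · simp [dist, Real.sqrt_sq h₀]
  · simp [dist, Real.arcosh_cosh h₀]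
  · simp [dist, Real.arccos_cos h₀ (h₁ rfl)]

theorem dist_zero_left (h₀ : 0 ≤ r) (h₁ : K = spherical → r ≤ Real.pi) : K.dist 0 r φ = r := by
  cases K
  · simp [dist, Real.sqrt_sq h₀]
  · simp [dist, Real.arcosh_cosh h₀]
  · simp [dist, Real.arccos_cos h₀ (h₁ rfl)]

theorem tendsto_angle {ι : Type*} {l : Filter ι} {f g h : ι → ℝ} (hf : Tendsto f l (𝓝 a))
    (hg : Tendsto g l (𝓝 b)) (hh : Tendsto h l (𝓝 c)) (hb : K.sn b ≠ 0) (hc : K.sn c ≠ 0) :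
    Tendsto (fun n => K.angle (f n) (g n) (h n)) l (𝓝 (K.angle a b c)) := by
  cases K <;> simp only [angle, sn] at *
  · exact (Real.continuous_arccos.tendsto _).comp
      ((((hg.pow 2).add (hh.pow 2)).sub (hf.pow 2)).div ((hg.const_mul 2).mul hh)
        (mul_ne_zero (mul_ne_zero two_ne_zero hb) hc))
  · exact (Real.continuous_arccos.tendsto _).comp
      (((((Real.continuous_cosh.tendsto _).comp hg).mul
        ((Real.continuous_cosh.tendsto _).comp hh)).sub
        ((Real.continuous_cosh.tendsto _).comp hf)).div (((Real.continuous_sinh.tendsto _).comp hg).mul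
        ((Real.continuous_sinh.tendsto _).comp hh)) (mul_ne_zero hb hc))
  · exact (Real.continuous_arccos.tendsto _).comp
      ((((Real.continuous_cos.tendsto _).comp hf).sub (((Real.continuous_cos.tendsto _).comp hg).mul
        ((Real.continuous_cos.tendsto _).comp hh))).div (((Real.continuous_sin.tendsto _).comp hg).mul
        ((Real.continuous_sin.tendsto _).comp hh)) (mul_ne_zero hb hc))

theorem angle_zero_left (hr : K.sn r ≠ 0) : K.angle 0 r r = 0 := by
  cases K <;> simp only [angle, sn] at *
  · rw [show (r ^ 2 + r ^ 2 - 0 ^ 2) / (2 * r * r) = 1 by field_simp; norm_num, Real.arccos_one]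
  · rw [show Real.cosh r * Real.cosh r - Real.cosh 0 = Real.sinh r * Real.sinh r by
      rw [Real.cosh_zero]; linarith [Real.cosh_sq r], div_self (mul_ne_zero hr hr), Real.arccos_one]
  · rw [show Real.cos 0 - Real.cos r * Real.cos r = Real.sin r * Real.sin r by
      rw [Real.cos_zero]; linarith [Real.sin_sq_add_cos_sq r], div_self (mul_ne_zero hr hr),
      Real.arccos_one]

/-- In the limit where the circle at the first corner shrinks to a point of intersection of the
other two circles, the angle there is the one made by the radii of those circles. -/
theorem angle_dist (hr : K.sn r ≠ 0) (hs : K.sn s ≠ 0) (h₀ : 0 ≤ φ) (h₁ : φ ≤ Real.pi) :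
    K.angle (K.dist r s φ) s r = Real.pi - φ := by
  have key : Real.arccos (-Real.cos φ) = Real.pi - φ := by
    rw [Real.arccos_neg, Real.arccos_cos h₀ h₁]
  rw [← key]
  cases K <;> simp only [angle, sn] at *
  · rw [dist_sq]
    congr 1
    field_simp
    ring
  · rw [cosh_dist]
    congr 1
    field_simp
    ring
  · rw [cos_dist]
    congr 1
    field_simp
    ring

/-- The angle sum of a triangle tends to `π` when one side shrinks to a point and the other two
stay bounded (on the sphere, by less than `π`). All three sides may shrink, at any rates. -/
theorem tendsto_angle_sum {ι : Type*} {l : Filter ι} {f g h : ι → ℝ} {ρ : ℝ} (h₀ : 0 ≤ ρ)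
    (h₁ : K = spherical → ρ < Real.pi) (hf : Tendsto f l (𝓝 0)) (hg : Tendsto g l (𝓝 ρ))
    (hh : Tendsto h l (𝓝 ρ)) (hlt₁ : ∀ n, f n < g n + h n) (hlt₂ : ∀ n, g n < h n + f n)
    (hlt₃ : ∀ n, h n < f n + g n) :
    Tendsto (fun n => K.angle (f n) (g n) (h n) + K.angle (g n) (h n) (f n)
      + K.angle (h n) (f n) (g n)) l (𝓝 Real.pi) := by
  have htri : ∀ᶠ n in l, K.IsTriangle (f n) (g n) (h n) ∧
      (K = spherical → h n + f n ≤ Real.pi) := by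
    by_cases hK : K = spherical
    · filter_upwards [((hf.add hg).add hh).eventually_lt_const
        (show 0 + ρ + ρ < 2 * Real.pi by linarith [h₁ hK]),
        (hh.add hf).eventually_lt_const (show ρ + 0 < Real.pi by linarith [h₁ hK])] with n h₂ h₃
      exact ⟨⟨hlt₁ n, hlt₂ n, hlt₃ n, fun _ => h₂⟩, fun _ => h₃.le⟩
    · exact Eventually.of_forall fun n =>
        ⟨⟨hlt₁ n, hlt₂ n, hlt₃ n, fun hs => absurd hs hK⟩, fun hs => absurd hs hK⟩
  have ts : ∀ {u : ι → ℝ} {x : ℝ}, Tendsto u l (𝓝 x) →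
      Tendsto (fun n => K.sn (u n)) l (𝓝 (K.sn x)) :=
    fun hu => (continuous_sn.tendsto _).comp hu
  have tc : ∀ {u : ι → ℝ} {x : ℝ}, Tendsto u l (𝓝 x) →
      Tendsto (fun n => K.cs (u n)) l (𝓝 (K.cs x)) :=
    fun hu => (continuous_cs.tendsto _).comp hu
  have hC := (((tc (hf.div_const 2)).mul (tc (hg.div_const 2))).mul
    (tc (hh.div_const 2))).pow 2 |>.const_mul 4
  have hN := ((((ts (((hf.add hg).add hh).div_const 2)).mul
    (ts (((hg.add hh).sub hf).div_const 2))).mul (ts (((hh.add hf).sub hg).div_const 2))).mul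
    (ts (((hf.add hg).sub hh).div_const 2))).const_mul (K.gauss ^ 2)
  have h0 : 0 < K.cs (0 / 2) := cs_pos (by simp) fun _ => by simp [Real.pi_pos]
  have hρ : 0 < K.cs (ρ / 2) := cs_pos (by linarith) fun hs => by linarith [h₁ hs]
  have hsq : Tendsto (fun n => Real.cos (K.halfSum (f n) (g n) (h n)) ^ 2) l (𝓝 0) := by
    have hq := hN.div hC (by positivity)
    -- the factor `sn ((h + f - g) / 2)` tends to `sn 0`
    rw [show (ρ + 0 - ρ) / 2 = 0 by ring, sn_zero] at hq
    simp only [mul_zero, zero_mul, zero_div] at hq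
    refine hq.congr' ?_
    have := hC.eventually_ne (b₂ := 0) (by positivity)
    filter_upwards [htri, this] with n hn hne
    rw [Pi.div_apply, ← hn.1.cos_halfSum_sq]
    exact mul_div_cancel_left₀ _ hne
  have hcos : Tendsto (fun n => Real.cos (K.halfSum (f n) (g n) (h n))) l (𝓝 0) := by
    rw [tendsto_zero_iff_abs_tendsto_zero]
    have := (Real.continuous_sqrt.tendsto 0).comp hsq
    rw [Real.sqrt_zero] at this
    exact this.congr fun n => Real.sqrt_sq_eq_abs _
  have hhalf := (((Real.continuous_arccos.tendsto 0).comp hcos).const_mul 2)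
  rw [Real.arccos_zero, mul_div_cancel₀ _ two_ne_zero] at hhalf
  refine hhalf.congr' ?_
  filter_upwards [htri] with n hn
  rw [Function.comp_apply, Real.arccos_cos hn.1.halfSum_mem.1.le (hn.1.halfSum_lt hn.2).le, halfSum]
  ring

theorem dist_nonneg (K : Background) (r s φ : ℝ) : 0 ≤ K.dist r s φ := by
  cases K
  · exact Real.sqrt_nonneg _
  · exact Real.arcosh_nonneg (one_le_cosh_mul_cosh_add r s φ)
  · exact Real.arccos_nonneg _

theorem dist_le_add (hK : K ≠ spherical) (hr : 0 ≤ r) (hs : 0 ≤ s) : K.dist r s φ ≤ r + s := by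
  have hc := Real.cos_le_one φ
  cases K
  · refine (Real.sqrt_le_left (by positivity)).2 ?_
    nlinarith [mul_nonneg (mul_nonneg hr hs) (sub_nonneg.2 hc)]
  · rw [← abs_of_nonneg (dist_nonneg hyperbolic r s φ), ← abs_of_nonneg (add_nonneg hr hs),
      ← Real.cosh_le_cosh, cosh_dist, Real.cosh_add]
    nlinarith [mul_nonneg (mul_nonneg (Real.sinh_nonneg_iff.2 hr) (Real.sinh_nonneg_iff.2 hs))
      (sub_nonneg.2 hc)]
  · exact absurd rfl hK

theorem dist_comm (K : Background) (r s φ : ℝ) : K.dist r s φ = K.dist s r φ := by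
  cases K <;> simp only [dist] <;> congr 1 <;> ring

theorem lt_dist_left (hK : K ≠ spherical) (hr : 0 < r) (hs : 0 < s) (hφ : 0 ≤ Real.cos φ) :
    r < K.dist r s φ := by
  cases K
  · refine Real.lt_sqrt_of_sq_lt ?_
    nlinarith [mul_nonneg (mul_pos hr hs).le hφ, sq_pos_of_pos hs]
  · rw [← abs_of_nonneg (dist_nonneg hyperbolic r s φ), ← abs_of_pos hr, ← Real.cosh_lt_cosh,
      abs_of_pos hr, cosh_dist]
    nlinarith [mul_nonneg (mul_pos (Real.sinh_pos_iff.2 hr) (Real.sinh_pos_iff.2 hs)).le hφ,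
      mul_pos (Real.cosh_pos r) (sub_pos.2 (Real.one_lt_cosh.2 hs.ne'))]
  · exact absurd rfl hK

theorem lt_dist_right (hK : K ≠ spherical) (hr : 0 < r) (hs : 0 < s) (hφ : 0 ≤ Real.cos φ) :
    s < K.dist r s φ := by
  rw [dist_comm]
  exact lt_dist_left hK hs hr hφ

/-- Thurston's lemma: for weights in `[0, π / 2]` in the Euclidean or hyperbolic plane, three
circles of any radii can be made to meet at the given angles. -/
theorem isTriangle_dist (hK : K ≠ spherical) (hr : 0 < r) (hs : 0 < s) (ht : 0 < t)
    (hφ : 0 ≤ Real.cos φ) (hψ : 0 ≤ Real.cos ψ) (hθ : 0 ≤ Real.cos θ) :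
    K.IsTriangle (K.dist s t φ) (K.dist t r ψ) (K.dist r s θ) := by
  refine ⟨?_, ?_, ?_, fun h => absurd h hK⟩
  · linarith [dist_le_add (φ := φ) hK hs.le ht.le, lt_dist_left hK ht hr hψ,
      lt_dist_right hK hr hs hθ]
  · linarith [dist_le_add (φ := ψ) hK ht.le hr.le, lt_dist_left hK hr hs hθ,
      lt_dist_right hK hs ht hφ]
  · linarith [dist_le_add (φ := θ) hK hr.le hs.le, lt_dist_left hK hs ht hφ,
      lt_dist_right hK ht hr hψ]

/-- With positive radii the inner angle is smaller than in the limit of `angle_dist`. -/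
theorem angle_dist_lt (hK : K ≠ spherical) (hr : 0 < r) (hs : 0 < s) (ht : 0 < t)
    (h₀ : 0 ≤ φ) (h₁ : φ ≤ Real.pi / 2) (hψ : 0 ≤ Real.cos ψ) (hθ : 0 ≤ Real.cos θ) :
    K.angle (K.dist s t φ) (K.dist t r ψ) (K.dist r s θ) < Real.pi - φ := by
  have hpi := Real.pi_pos
  have hφ : 0 ≤ Real.cos φ := Real.cos_nonneg_of_mem_Icc ⟨by linarith, h₁⟩
  have hb := lt_dist_left hK ht hr hψ
  have hc := lt_dist_right hK hr hs hθ
  -- `arccos u = 0` for `u ≥ 1`, and `φ < π`, so no upper bound on `u` is needed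
  have key : ∀ u, -Real.cos φ < u → Real.arccos u < Real.pi - φ := by
    intro u hu
    rw [← Real.arccos_cos h₀ (by linarith), ← Real.arccos_neg]
    rcases le_or_gt u 1 with hu1 | hu1
    · exact Real.arccos_lt_arccos (by linarith [Real.cos_le_one φ]) hu hu1
    · rw [Real.arccos_of_one_le hu1.le, Real.arccos_neg, Real.arccos_cos h₀ (by linarith)]
      linarith
  cases K
  · refine key _ ?_
    have hb0 := ht.trans hb
    have hc0 := hs.trans hc
    rw [lt_div_iff₀ (by positivity), dist_sq, dist_sq, dist_sq]
    have hbc : t * s ≤ euclidean.dist t r ψ * euclidean.dist r s θ :=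
      mul_le_mul hb.le hc.le hs.le hb0.le
    nlinarith [mul_nonneg (sub_nonneg.2 hbc) hφ, mul_nonneg (mul_pos ht hr).le hψ,
      mul_nonneg (mul_pos hr hs).le hθ, sq_pos_of_pos hr]
  · refine key _ ?_
    have hb0 := ht.trans hb
    have hc0 := hs.trans hc
    have sb := Real.sinh_pos_iff.2 hb0
    have sc := Real.sinh_pos_iff.2 hc0
    have hss := Real.sinh_pos_iff.2 hs
    rw [lt_div_iff₀ (mul_pos sb sc), cosh_dist s t φ]
    have hbc := mul_le_mul (Real.sinh_le_sinh.2 hb.le) (Real.sinh_le_sinh.2 hc.le) hss.le sb.le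
    have hcc : Real.cosh t * Real.cosh s
        < Real.cosh (hyperbolic.dist t r ψ) * Real.cosh (hyperbolic.dist r s θ) :=
      mul_lt_mul'' (Real.cosh_lt_cosh.2 (by rwa [abs_of_pos ht, abs_of_pos hb0]))
        (Real.cosh_lt_cosh.2 (by rwa [abs_of_pos hs, abs_of_pos hc0])) (Real.cosh_pos _).le
        (Real.cosh_pos _).le
    nlinarith [mul_le_mul_of_nonneg_right hbc hφ]
  · exact absurd rfl hK

end Background

/-! ### Counting cells triangle by triangle -/

namespace TriangulatedSurface

variable {F : Type*} (T : TriangulatedSurface F)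

@[simp] theorem _root_.OrientedSide.rev_rev (s : OrientedSide F) : s.rev.rev = s := rfl

theorem _root_.OrientedSide.rev_ne (s : OrientedSide F) : s.rev ≠ s := fun h =>
  s.ne (congrArg OrientedSide.tgt h)

theorem edge_rev (s : OrientedSide F) : T.edge s.rev = T.edge s :=
  (Quot.sound (r := T.SideRel) (Or.inl rfl)).symm

theorem edge_glue (s : OrientedSide F) : T.edge (T.glue s) = T.edge s :=
  (Quot.sound (r := T.SideRel) (Or.inr rfl)).symm

theorem vertex_glue (s : OrientedSide F) :
    T.vertex (T.glue s).tri (T.glue s).src = T.vertex s.tri s.src :=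
  (Quot.sound ⟨s, rfl, rfl⟩).symm

theorem vertex_glue_tgt (s : OrientedSide F) :
    T.vertex (T.glue s).tri (T.glue s).tgt = T.vertex s.tri s.tgt := by
  have h := T.vertex_glue s.rev
  rwa [T.glue_rev] at h

/-- Each edge is carried by four oriented sides: the two orientations of two glued sides. -/
theorem edge_eq_edge_iff {s t : OrientedSide F} :
    T.edge t = T.edge s ↔ t = s ∨ t = s.rev ∨ t = T.glue s ∨ t = (T.glue s).rev := by
  constructor
  · intro h
    replace h := Quot.eqvGen_exact h
    induction h with
    | rel x y h =>
      rcases h with rfl | rfl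
      · simp
      · simp [T.glue_glue]
    | refl => simp
    | symm x y _ ih =>
      rcases ih with rfl | rfl | rfl | rfl <;> simp [T.glue_glue, T.glue_rev]
    | trans x y z _ _ ih₁ ih₂ =>
      rcases ih₁ with rfl | rfl | rfl | rfl <;> rcases ih₂ with rfl | rfl | rfl | rfl <;>
        simp [T.glue_glue, T.glue_rev]
  · rintro (rfl | rfl | rfl | rfl) <;> simp only [edge_rev, edge_glue]

theorem ends_edge (s : OrientedSide F) :
    T.ends (T.edge s) = {T.vertex s.tri s.src, T.vertex s.tri s.tgt} := by
  ext v
  simp only [ends, Set.mem_ofPred_eq, T.edge_eq_edge_iff, Set.mem_insert_iff, Set.mem_singleton_iff]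
  constructor
  · rintro ⟨t, rfl | rfl | rfl | rfl, rfl⟩
    · exact Or.inl rfl
    · exact Or.inr rfl
    · exact Or.inl (T.vertex_glue s)
    · exact Or.inr (T.vertex_glue_tgt s)
  · rintro (rfl | rfl)
    · exact ⟨s, Or.inl rfl, rfl⟩
    · exact ⟨s.rev, Or.inr (Or.inl rfl), rfl⟩

theorem ends_oppEdge (f : F) (a : Fin 3) :
    T.ends (T.oppEdge f a) = {T.vertex f (a + 1), T.vertex f (a + 2)} :=
  T.ends_edge _

theorem ends_edge_subset_iff {s : OrientedSide F} {I : Set T.Vertex} :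
    T.ends (T.edge s) ⊆ I ↔ T.vertex s.tri s.src ∈ I ∧ T.vertex s.tri s.tgt ∈ I := by
  simp [ends_edge, Set.insert_subset_iff]

theorem mem_link [Fintype F] {I : Finset T.Vertex} {c : F × Fin 3} :
    c ∈ T.link I ↔ T.vertex c.1 (c.2 + 1) ∉ I ∧ T.vertex c.1 (c.2 + 2) ∉ I ∧
      T.vertex c.1 c.2 ∈ I := by
  simp [link, ends_oppEdge, and_assoc]

instance [Fintype F] : Fintype (OrientedSide F) := Fintype.ofFinite _

/-- An oriented side as a triangle together with an ordered pair of distinct corners. -/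
def sideEquiv (F : Type*) : OrientedSide F ≃ F × {p : Fin 3 × Fin 3 // p.1 ≠ p.2} where
  toFun s := (s.tri, ⟨(s.src, s.tgt), s.ne⟩)
  invFun q := ⟨q.1, q.2.1.1, q.2.1.2, q.2.2⟩
  left_inv _ := rfl
  right_inv _ := rfl

open Classical in
/-- Each edge inside `I` is counted four times by the oriented sides with both ends in `I`. -/
theorem card_edge_eq [Fintype F] (I : Set T.Vertex) :
    4 * Nat.card {e : T.Edge // T.ends e ⊆ I}
      = (Finset.univ.filter fun s : OrientedSide F =>
          T.vertex s.tri s.src ∈ I ∧ T.vertex s.tri s.tgt ∈ I).card := by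
  rw [Nat.card_eq_fintype_card, Fintype.card_subtype, Finset.card_eq_sum_card_fiberwise
    (f := T.edge) (t := Finset.univ.filter fun e : T.Edge => T.ends e ⊆ I)]
  · rw [Finset.sum_const_nat (m := 4), mul_comm]
    intro e he
    obtain ⟨s, rfl⟩ := Quot.exists_rep e
    change Finset.card {t ∈ _ | T.edge t = T.edge s} = 4
    have hs : T.ends (T.edge s) ⊆ I := (Finset.mem_filter.1 he).2
    have hne : T.glue s ≠ s.rev := T.glue_ne_rev s
    have hfib : ({t ∈ Finset.univ.filter fun s : OrientedSide F =>
        T.vertex s.tri s.src ∈ I ∧ T.vertex s.tri s.tgt ∈ I | T.edge t = T.edge s})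
        = {s, s.rev, T.glue s, (T.glue s).rev} := by
      ext t
      simp only [Finset.mem_filter, Finset.mem_univ, true_and, Finset.mem_insert,
        Finset.mem_singleton, ← T.edge_eq_edge_iff]
      refine ⟨fun h => h.2, fun h => ⟨?_, h⟩⟩
      rw [← T.ends_edge_subset_iff, h]
      exact hs
    rw [hfib]
    have h1 : s ≠ s.rev := (s.rev_ne).symm
    have h2 : s ≠ T.glue s := (T.glue_ne s).symm
    have h3 : s ≠ (T.glue s).rev := fun h => hne (congrArg OrientedSide.rev h).symm
    have h4 : s.rev ≠ (T.glue s).rev := fun h => h2 (congrArg OrientedSide.rev h)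
    have h5 : T.glue s ≠ (T.glue s).rev := ((T.glue s).rev_ne).symm
    rw [Finset.card_insert_of_notMem (by simp [h1, h2, h3]),
      Finset.card_insert_of_notMem (by simp [hne.symm, h4]),
      Finset.card_insert_of_notMem (by simp [h5]), Finset.card_singleton]
  · intro s hs
    simpa [ends_edge_subset_iff] using hs

open Classical in
/-- The contribution of the triangle `f` to the limit of the sum of all inner angles at the corners
in `I`: `π` if two or three corners are in `I`, and `π - Φ(e)` if the corner opposite to the edge
`e` is the only one in `I`. It is written as the contribution of `f` to the link, plus `π` for each
side inside `I`, minus `2π` if the triangle is inside `I`, which is how `f` enters the right side of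
the theorem. -/
def limitAngle (Φ : T.Edge → ℝ) (I : Finset T.Vertex) (f : F) : ℝ :=
  ∑ a : Fin 3, ((if T.vertex f (a + 1) ∉ I ∧ T.vertex f (a + 2) ∉ I ∧ T.vertex f a ∈ I then
      Real.pi - Φ (T.oppEdge f a) else 0)
    + if T.vertex f (a + 1) ∈ I ∧ T.vertex f (a + 2) ∈ I then Real.pi else 0)
    - if ∀ a, T.vertex f a ∈ I then 2 * Real.pi else 0

open Classical in
/-- Each edge inside `I` is the side of two triangles (or twice of one); the side is recorded by the
opposite corner `a`. -/
theorem two_mul_card_edge [Fintype F] (I : Finset T.Vertex) :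
    2 * (Nat.card {e : T.Edge // T.ends e ⊆ I} : ℝ) = ∑ f : F, ∑ a : Fin 3,
      if T.vertex f (a + 1) ∈ I ∧ T.vertex f (a + 2) ∈ I then 1 else 0 := by
  have h := congrArg (Nat.cast : ℕ → ℝ) (T.card_edge_eq (I : Set T.Vertex))
  have hs := Fintype.sum_equiv (sideEquiv F) (fun s => if T.vertex s.tri s.src ∈ I ∧
    T.vertex s.tri s.tgt ∈ I then (1 : ℝ) else 0) (fun q =>
    if T.vertex q.1 q.2.1.1 ∈ I ∧ T.vertex q.1 q.2.1.2 ∈ I then 1 else 0) (fun _ => rfl)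
  simp only [Finset.natCast_card_filter, Finset.mem_coe] at h
  rw [hs, Fintype.sum_prod_type] at h
  push_cast at h
  have h2 : ∀ f : F, (∑ p : {p : Fin 3 × Fin 3 // p.1 ≠ p.2},
      if T.vertex f p.1.1 ∈ I ∧ T.vertex f p.1.2 ∈ I then (1 : ℝ) else 0)
      = 2 * ∑ a : Fin 3, if T.vertex f (a + 1) ∈ I ∧ T.vertex f (a + 2) ∈ I then 1 else 0 := by
    intro f
    rw [← Finset.sum_subtype (Finset.univ.filter fun p : Fin 3 × Fin 3 => p.1 ≠ p.2) (by simp)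
      (fun p : Fin 3 × Fin 3 => if T.vertex f p.1 ∈ I ∧ T.vertex f p.2 ∈ I then (1 : ℝ) else 0),
      show (Finset.univ.filter fun p : Fin 3 × Fin 3 => p.1 ≠ p.2)
        = {(0, 1), (0, 2), (1, 0), (1, 2), (2, 0), (2, 1)} by decide]
    rw [Finset.sum_insert (by decide), Finset.sum_insert (by decide), Finset.sum_insert (by decide),
      Finset.sum_insert (by decide), Finset.sum_insert (by decide), Finset.sum_singleton,
      Fin.sum_univ_three, show (0 + 1 : Fin 3) = 1 from rfl, show (0 + 2 : Fin 3) = 2 from rfl,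
      show (1 + 1 : Fin 3) = 2 from rfl, show (1 + 2 : Fin 3) = 0 from rfl,
      show (2 + 1 : Fin 3) = 0 from rfl, show (2 + 2 : Fin 3) = 1 from rfl]
    simp only [and_comm]
    by_cases h0 : T.vertex f 0 ∈ I <;> by_cases h1 : T.vertex f 1 ∈ I <;>
      by_cases h2 : T.vertex f 2 ∈ I <;> simp only [h0, h1, h2] <;> norm_num
  simp only [h2, ← Finset.mul_sum] at h
  linarith

/-- The combinatorial expression of the theorem, triangle by triangle. -/
theorem sum_limitAngle [Fintype F] (Φ : T.Edge → ℝ) (I : Finset T.Vertex) :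
    -∑ c ∈ T.link I, (Real.pi - Φ (T.oppEdge c.1 c.2)) + 2 * Real.pi * (T.eulerChar I : ℝ)
      = 2 * Real.pi * I.card - ∑ f, T.limitAngle Φ I f := by
  classical
  have h := T.two_mul_card_edge I
  have hl : ∑ c ∈ T.link I, (Real.pi - Φ (T.oppEdge c.1 c.2))
      = ∑ f : F, ∑ a : Fin 3,
        if T.vertex f (a + 1) ∉ I ∧ T.vertex f (a + 2) ∉ I ∧ T.vertex f a ∈ I then
          Real.pi - Φ (T.oppEdge f a) else 0 := by
    rw [← Fintype.sum_prod_type', ← Finset.sum_filter]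
    refine Finset.sum_congr ?_ fun _ _ => rfl
    ext c
    simp [mem_link]
  have h3 : (∑ f : F, if ∀ a, T.vertex f a ∈ I then 2 * Real.pi else 0)
      = 2 * Real.pi * (Nat.card {f : F // ∀ a, T.vertex f a ∈ I} : ℝ) := by
    rw [Nat.card_eq_fintype_card, Fintype.card_subtype, Finset.natCast_card_filter, Finset.mul_sum]
    simp
  have h2 : (∑ f : F, ∑ a : Fin 3,
      if T.vertex f (a + 1) ∈ I ∧ T.vertex f (a + 2) ∈ I then Real.pi else 0)
      = Real.pi * (2 * (Nat.card {e : T.Edge // T.ends e ⊆ I} : ℝ)) := by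
    simp only [h, Finset.mul_sum, mul_ite, mul_one, mul_zero]
  rw [hl]
  simp only [limitAngle, Finset.sum_sub_distrib, Finset.sum_add_distrib, h2, h3, eulerChar]
  push_cast
  ring

open Classical in
/-- The sum of the inner angles of `f` at the corners in `I`. -/
def partialAngle (K : Background) (Φ : T.Edge → ℝ) (r : T.Vertex → ℝ) (I : Finset T.Vertex)
    (f : F) : ℝ :=
  ∑ a : Fin 3, if T.vertex f a ∈ I then T.innerAngle K Φ r f a else 0

theorem sum_curvature [Fintype F] (K : Background) (Φ : T.Edge → ℝ) (r : T.Vertex → ℝ)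
    (I : Finset T.Vertex) :
    ∑ v ∈ I, T.curvature K Φ r v = 2 * Real.pi * I.card - ∑ f, T.partialAngle K Φ r I f := by
  classical
  simp only [curvature, partialAngle, Finset.sum_sub_distrib, Finset.sum_const, nsmul_eq_mul]
  rw [← Fintype.sum_prod_type', ← Finset.sum_filter, mul_comm]
  congr 1
  rw [← Finset.sum_fiberwise_of_maps_to (t := I) (g := fun c : F × Fin 3 => T.vertex c.1 c.2)
    (by simp)]
  refine Finset.sum_congr rfl fun v hv => Finset.sum_congr ?_ fun _ _ => rfl
  ext c
  simp only [Finset.mem_filter, Finset.mem_univ, true_and]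
  exact ⟨fun h => ⟨h ▸ hv, h⟩, fun h => h.2⟩

/-- In a connected surface, a non-empty proper set of vertices has a triangle with corners both
inside and outside of the set. -/
theorem Connected.exists_mixed_triangle [Fintype F] {T : TriangulatedSurface F} (hT : T.Connected)
    {I : Finset T.Vertex} (h₀ : I.Nonempty) (h₁ : I ≠ Finset.univ) :
    ∃ f a b, T.vertex f a ∈ I ∧ T.vertex f b ∉ I := by
  by_contra! hno
  obtain ⟨v, hv⟩ := h₀
  obtain ⟨w, hw⟩ : ∃ w, w ∉ I := by
    by_contra! h
    exact h₁ (Finset.eq_univ_of_forall h)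
  obtain ⟨⟨f, a⟩, rfl⟩ := Quot.exists_rep v
  obtain ⟨⟨g, b⟩, rfl⟩ := Quot.exists_rep w
  have key : ∀ g, Relation.ReflTransGen
      (fun f₁ f₂ => ∃ s : OrientedSide F, s.tri = f₁ ∧ (T.glue s).tri = f₂) f g →
      ∀ a, T.vertex g a ∈ I := by
    intro g hg
    induction hg with
    | refl => exact fun b => hno f a b hv
    | tail _ h ih =>
      obtain ⟨s, rfl, rfl⟩ := h
      exact fun b => hno _ _ b (T.vertex_glue s ▸ ih s.src)
  exact hw (key g (hT f g) b)

end TriangulatedSurface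

/-! ### The angles of one triangle of a circle packing -/

namespace TriangulatedSurface

variable {F : Type*} (T : TriangulatedSurface F) {K : Background} {Φ : T.Edge → ℝ} {f : F}
  {a b c : Fin 3}

theorem _root_.Fin.three_cyclic : ∀ {a b c : Fin 3}, a + 1 = b → a + 2 = c →
    b + 1 = c ∧ b + 2 = a ∧ c + 1 = a ∧ c + 2 = b := by
  decide

/-- The limit of the single inner angle at `I`, when the circles at the other two corners keep
positive radii. -/
theorem tendsto_innerAngle {ι : Type*} {l : Filter ι} {r : ι → T.Vertex → ℝ} {ρ : T.Vertex → ℝ}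
    (hΦ : ∀ e, Φ e ∈ Set.Ico 0 Real.pi) (hr : ∀ v, Tendsto (fun n => r n v) l (𝓝 (ρ v)))
    (hρ : K = Background.spherical → ∀ v, ρ v < Real.pi) (hb : a + 1 = b) (hc : a + 2 = c)
    (h₁ : ρ (T.vertex f a) = 0) (h₂ : 0 < ρ (T.vertex f b)) (h₃ : 0 < ρ (T.vertex f c)) :
    Tendsto (fun n => T.innerAngle K Φ (r n) f a) l (𝓝 (Real.pi - Φ (T.oppEdge f a))) := by
  obtain ⟨e₁, e₂, e₃, e₄⟩ : b + 1 = c ∧ b + 2 = a ∧ c + 1 = a ∧ c + 2 = b :=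
    Fin.three_cyclic hb hc
  have hd : ∀ u v φ, Tendsto (fun n => K.dist (r n u) (r n v) φ) l (𝓝 (K.dist (ρ u) (ρ v) φ)) :=
    fun u v φ => ((K.continuous_dist φ).tendsto (ρ u, ρ v)).comp ((hr u).prodMk_nhds (hr v))
  have s₂ := Background.sn_pos (K := K) h₂ fun hK => hρ hK _
  have s₃ := Background.sn_pos (K := K) h₃ fun hK => hρ hK _
  simp only [innerAngle, sideLength, hb, hc, e₁, e₂, e₃, e₄]
  rw [← Background.angle_dist s₂.ne' s₃.ne' (hΦ _).1 (hΦ _).2.le]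
  have l₂ := hd (T.vertex f c) (T.vertex f a) (Φ (T.oppEdge f b))
  have l₃ := hd (T.vertex f a) (T.vertex f b) (Φ (T.oppEdge f c))
  rw [h₁, Background.dist_zero_right h₃.le fun hK => (hρ hK _).le] at l₂
  rw [h₁, Background.dist_zero_left h₂.le fun hK => (hρ hK _).le] at l₃
  exact Background.tendsto_angle (hd _ _ _) l₂ l₃ s₃.ne' s₂.ne'

/-- If two circles of a triangle shrink to points, then its angle sum tends to `π`; if moreover the
third circle does not shrink, then the two angles at the shrinking circles carry all of the sum. -/
theorem tendsto_sum_innerAngle {ι : Type*} {l : Filter ι} {r : ι → T.Vertex → ℝ}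
    {ρ : T.Vertex → ℝ} (hpack : ∀ n, T.IsCirclePackingMetric K Φ (r n))
    (hr : ∀ v, Tendsto (fun n => r n v) l (𝓝 (ρ v))) (hρ₀ : ∀ v, 0 ≤ ρ v)
    (hρ : K = Background.spherical → ∀ v, ρ v < Real.pi) (hb : a + 1 = b) (hc : a + 2 = c)
    (h₂ : ρ (T.vertex f b) = 0) (h₃ : ρ (T.vertex f c) = 0) :
    Tendsto (fun n => T.innerAngle K Φ (r n) f a + T.innerAngle K Φ (r n) f b
        + T.innerAngle K Φ (r n) f c) l (𝓝 Real.pi) ∧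
      (0 < ρ (T.vertex f a) → Tendsto (fun n => T.innerAngle K Φ (r n) f b
        + T.innerAngle K Φ (r n) f c) l (𝓝 Real.pi)) := by
  obtain ⟨e₁, e₂, e₃, e₄⟩ : b + 1 = c ∧ b + 2 = a ∧ c + 1 = a ∧ c + 2 = b :=
    Fin.three_cyclic hb hc
  have hd : ∀ u v φ, Tendsto (fun n => K.dist (r n u) (r n v) φ) l (𝓝 (K.dist (ρ u) (ρ v) φ)) :=
    fun u v φ => ((K.continuous_dist φ).tendsto (ρ u, ρ v)).comp ((hr u).prodMk_nhds (hr v))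
  have l₁ : Tendsto (fun n => T.sideLength K Φ (r n) f a) l (𝓝 0) := by
    have := hd (T.vertex f b) (T.vertex f c) (Φ (T.oppEdge f a))
    rw [h₂, h₃, Background.dist_zero_right le_rfl fun _ => Real.pi_pos.le] at this
    simpa only [sideLength, hb, hc] using this
  have l₂ : Tendsto (fun n => T.sideLength K Φ (r n) f b) l (𝓝 (ρ (T.vertex f a))) := by
    have := hd (T.vertex f c) (T.vertex f a) (Φ (T.oppEdge f b))
    rw [h₃, Background.dist_zero_left (hρ₀ _) fun hK => (hρ hK _).le] at this
    simpa only [sideLength, e₁, e₂] using this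
  have l₃ : Tendsto (fun n => T.sideLength K Φ (r n) f c) l (𝓝 (ρ (T.vertex f a))) := by
    have := hd (T.vertex f a) (T.vertex f b) (Φ (T.oppEdge f c))
    rw [h₂, Background.dist_zero_right (hρ₀ _) fun hK => (hρ hK _).le] at this
    simpa only [sideLength, e₃, e₄] using this
  have hsum := Background.tendsto_angle_sum (K := K) (hρ₀ _) (fun hK => hρ hK _) l₁ l₂ l₃
    (fun n => by simpa only [hb, hc] using (hpack n).triangle f a)
    (fun n => by simpa only [e₁, e₂] using (hpack n).triangle f b)
    (fun n => by simpa only [e₃, e₄] using (hpack n).triangle f c)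
  simp only [innerAngle, hb, hc, e₁, e₂, e₃, e₄]
  refine ⟨hsum, fun h₁ => ?_⟩
  have s := Background.sn_pos (K := K) h₁ fun hK => hρ hK _
  have h0 := Background.tendsto_angle l₁ l₂ l₃ s.ne' s.ne'
  rw [Background.angle_zero_left s.ne'] at h0
  simpa [add_assoc] using hsum.sub h0

theorem tendsto_partialAngle {ι : Type*} {l : Filter ι} {r : ι → T.Vertex → ℝ}
    {ρ : T.Vertex → ℝ} {I : Finset T.Vertex} (hΦ : ∀ e, Φ e ∈ Set.Ico 0 Real.pi)
    (hpack : ∀ n, T.IsCirclePackingMetric K Φ (r n))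
    (hr : ∀ v, Tendsto (fun n => r n v) l (𝓝 (ρ v)))
    (hρ : K = Background.spherical → ∀ v, ρ v < Real.pi)
    (hI : ∀ v ∈ I, ρ v = 0) (hI' : ∀ v ∉ I, 0 < ρ v) (f : F) :
    Tendsto (fun n => T.partialAngle K Φ (r n) I f) l (𝓝 (T.limitAngle Φ I f)) := by
  classical
  have hρ₀ : ∀ v, 0 ≤ ρ v := fun v => by
    by_cases hv : v ∈ I
    · exact (hI v hv).ge
    · exact (hI' v hv).le
  have one := fun (a b c : Fin 3) (hb : a + 1 = b) (hc : a + 2 = c) (h₁ : T.vertex f a ∈ I)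
    (h₂ : T.vertex f b ∉ I) (h₃ : T.vertex f c ∉ I) =>
      T.tendsto_innerAngle hΦ hr hρ hb hc (hI _ h₁) (hI' _ h₂) (hI' _ h₃)
  have two := fun (a b c : Fin 3) (hb : a + 1 = b) (hc : a + 2 = c) (h₁ : T.vertex f a ∉ I)
    (h₂ : T.vertex f b ∈ I) (h₃ : T.vertex f c ∈ I) =>
      (T.tendsto_sum_innerAngle hpack hr hρ₀ hρ hb hc (hI _ h₂) (hI _ h₃)).2 (hI' _ h₁)
  simp only [partialAngle, limitAngle, Fin.sum_univ_three, Fin.forall_fin_succ,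
    show (0 + 1 : Fin 3) = 1 from rfl, show (0 + 2 : Fin 3) = 2 from rfl,
    show (1 + 1 : Fin 3) = 2 from rfl, show (1 + 2 : Fin 3) = 0 from rfl,
    show (2 + 1 : Fin 3) = 0 from rfl, show (2 + 2 : Fin 3) = 1 from rfl]
  by_cases h0 : T.vertex f 0 ∈ I <;> by_cases h1 : T.vertex f 1 ∈ I <;>
    by_cases h2 : T.vertex f 2 ∈ I <;> simp [h0, h1, h2]
  · convert (T.tendsto_sum_innerAngle (f := f) hpack hr hρ₀ hρ (a := 0) (b := 1) (c := 2) rfl rfl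
      (hI _ h1) (hI _ h2)).1 using 2
    ring
  · exact two 2 0 1 rfl rfl h2 h0 h1
  · simpa only [add_comm] using two 1 2 0 rfl rfl h1 h2 h0
  · exact one 0 1 2 rfl rfl h0 h1 h2
  · exact two 0 1 2 rfl rfl h0 h1 h2
  · exact one 1 2 0 rfl rfl h1 h2 h0
  · exact one 2 0 1 rfl rfl h2 h0 h1
  · exact tendsto_const_nhds

theorem isTriangle_sideLength (hK : K ≠ Background.spherical)
    (hΦ : ∀ e, Φ e ∈ Set.Icc 0 (Real.pi / 2)) {r : T.Vertex → ℝ} (hr : ∀ v, 0 < r v) :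
    K.IsTriangle (T.sideLength K Φ r f 0) (T.sideLength K Φ r f 1) (T.sideLength K Φ r f 2) :=
  have hcos : ∀ e, 0 ≤ Real.cos (Φ e) := fun e =>
    Real.cos_nonneg_of_mem_Icc ⟨by linarith [(hΦ e).1, Real.pi_pos], (hΦ e).2⟩
  Background.isTriangle_dist hK (hr _) (hr _) (hr _) (hcos _) (hcos _) (hcos _)

theorem innerAngle_lt (hK : K ≠ Background.spherical) (hΦ : ∀ e, Φ e ∈ Set.Icc 0 (Real.pi / 2))
    {r : T.Vertex → ℝ} (hr : ∀ v, 0 < r v) (f : F) (a : Fin 3) :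
    T.innerAngle K Φ r f a < Real.pi - Φ (T.oppEdge f a) := by
  have hcos : ∀ e, 0 ≤ Real.cos (Φ e) := fun e =>
    Real.cos_nonneg_of_mem_Icc ⟨by linarith [(hΦ e).1, Real.pi_pos], (hΦ e).2⟩
  obtain ⟨e₁, e₂, e₃, e₄⟩ : a + 1 + 1 = a + 2 ∧ a + 1 + 2 = a ∧ a + 2 + 1 = a ∧
      a + 2 + 2 = a + 1 := by
    revert a; decide
  simp only [innerAngle, sideLength, e₁, e₂, e₃, e₄]
  exact Background.angle_dist_lt hK (hr _) (hr _) (hr _) (hΦ _).1 (hΦ _).2 (hcos _) (hcos _)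

/-- For weights in `[0, π / 2]` in the Euclidean or hyperbolic plane, each triangle has less angle in
`I` than in the limit, strictly so if it has corners both inside and outside of `I`. -/
theorem partialAngle_le (hK : K ≠ Background.spherical) (hΦ : ∀ e, Φ e ∈ Set.Icc 0 (Real.pi / 2))
    {r : T.Vertex → ℝ} (hr : ∀ v, 0 < r v) (I : Finset T.Vertex) (f : F) :
    T.partialAngle K Φ r I f ≤ T.limitAngle Φ I f ∧
      ((∃ a b, T.vertex f a ∈ I ∧ T.vertex f b ∉ I) →
        T.partialAngle K Φ r I f < T.limitAngle Φ I f) := by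
  classical
  have htri := T.isTriangle_sideLength (f := f) hK hΦ hr
  have hsum := htri.angle_sum_le (by cases K <;> simp_all [Background.gauss])
  have p₀ := htri.angle_pos
  have p₁ := htri.rotate.angle_pos
  have p₂ := htri.rotate.rotate.angle_pos
  have l₀ := T.innerAngle_lt hK hΦ hr f 0
  have l₁ := T.innerAngle_lt hK hΦ hr f 1
  have l₂ := T.innerAngle_lt hK hΦ hr f 2
  change 0 < T.innerAngle K Φ r f 0 at p₀
  change 0 < T.innerAngle K Φ r f 1 at p₁
  change 0 < T.innerAngle K Φ r f 2 at p₂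
  change T.innerAngle K Φ r f 0 + T.innerAngle K Φ r f 1 + T.innerAngle K Φ r f 2 ≤ Real.pi at hsum
  simp only [partialAngle, limitAngle, Fin.sum_univ_three, Fin.forall_fin_succ, Fin.exists_fin_succ,
    show (0 + 1 : Fin 3) = 1 from rfl, show (0 + 2 : Fin 3) = 2 from rfl,
    show (1 + 1 : Fin 3) = 2 from rfl, show (1 + 2 : Fin 3) = 0 from rfl,
    show (2 + 1 : Fin 3) = 0 from rfl, show (2 + 2 : Fin 3) = 1 from rfl]
  by_cases h0 : T.vertex f 0 ∈ I <;> by_cases h1 : T.vertex f 1 ∈ I <;>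
    by_cases h2 : T.vertex f 2 ∈ I <;> simp [h0, h1, h2] <;>
    first | linarith | (constructor <;> linarith)

end TriangulatedSurface

end

/-! ### The limit and the inequality -/

theorem proposition4p1 {F : Type*} [Fintype F] (T : TriangulatedSurface F) (Φ : T.Edge → ℝ) :
    ((∀ e, Φ e ∈ Set.Ico 0 Real.pi) →
      ∀ (K : Background) (I : Finset T.Vertex) (r : ℕ → T.Vertex → ℝ),
        (∀ n, T.IsCirclePackingMetric K Φ (r n)) →
        (∀ v ∈ I, Tendsto (fun n => r n v) atTop (𝓝 0)) →
        (∀ v ∉ I, ∃ ρ : ℝ, 0 < ρ ∧ (K = Background.spherical → ρ < Real.pi) ∧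
          Tendsto (fun n => r n v) atTop (𝓝 ρ)) →
        Tendsto (fun n => ∑ v ∈ I, T.curvature K Φ (r n) v) atTop
          (𝓝 (-∑ c ∈ T.link I, (Real.pi - Φ (T.oppEdge c.1 c.2))
            + 2 * Real.pi * (T.eulerChar I : ℝ)))) ∧
    (T.Connected → (∀ e, Φ e ∈ Set.Icc 0 (Real.pi / 2)) →
      ∀ K : Background, K = Background.euclidean ∨ K = Background.hyperbolic →
      ∀ r : T.Vertex → ℝ, (∀ v, 0 < r v) →
      ∀ I : Finset T.Vertex, I.Nonempty → I ≠ Finset.univ →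
        -∑ c ∈ T.link I, (Real.pi - Φ (T.oppEdge c.1 c.2)) + 2 * Real.pi * (T.eulerChar I : ℝ)
          < ∑ v ∈ I, T.curvature K Φ r v) := by
  constructor
  · intro hΦ K I r hpack hI hI'
    have hlim : ∀ v, ∃ ρ : ℝ, (v ∈ I → ρ = 0) ∧ (v ∉ I → 0 < ρ) ∧
        (K = Background.spherical → ρ < Real.pi) ∧ Tendsto (fun n => r n v) atTop (𝓝 ρ) := by
      intro v
      by_cases hv : v ∈ I
      · exact ⟨0, fun _ => rfl, fun h => absurd hv h, fun _ => Real.pi_pos, hI v hv⟩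
      · obtain ⟨ρ, h₁, h₂, h₃⟩ := hI' v hv
        exact ⟨ρ, fun h => absurd h hv, fun _ => h₁, h₂, h₃⟩
    choose ρ h₁ h₂ h₃ h₄ using hlim
    rw [T.sum_limitAngle]
    simp only [T.sum_curvature]
    exact tendsto_const_nhds.sub (tendsto_finsetSum _ fun f _ =>
      T.tendsto_partialAngle hΦ hpack h₄ (fun hK v => h₃ v hK) h₁ h₂ f)
  · intro hT hΦ K hK r hr I hI₀ hI₁
    have hns : K ≠ Background.spherical := by rcases hK with rfl | rfl <;> simp
    obtain ⟨f, hf⟩ := hT.exists_mixed_triangle hI₀ hI₁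
    rw [T.sum_limitAngle, T.sum_curvature]
    exact sub_lt_sub_left (Finset.sum_lt_sum (fun f _ => (T.partialAngle_le hns hΦ hr I f).1)
      ⟨f, Finset.mem_univ f, (T.partialAngle_le hns hΦ hr I f).2 hf⟩) _
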